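/- Let $V$ be the vertex set of the semi-infinite Cayley tree of order $k$: vertices are the words $(i_1,\dots,i_n)$ over $\{1,\dots,k\}$, the root $o$ is the empty word, $W_n$ is the set of words of length $n$, $\Lambda_n=\bigcup_{j\le n}W_j$, and $S(x)=\{(x,1),\dots,(x,k)\}$. A ray is a sequence $r=(x_n)_{n\ge0}$ with $x_0=o$ and $x_{n+1}\in S(x_n)$. Let $\mathcal A$ be a unital C*-algebra of operators on a Hilbert space $\ell^2(I)$ (containing the identity), $\mathrm{Tr}$ the standard trace on positive operators (with values in $[0,\infty]$), $\mathcal A_\Lambda=\bigotimes_{x\in\Lambda}\mathcal A$ (spatial tensor product) for $\Lambda\subseteq V$, so that $\mathcal A_V$ is the norm closure of $\bigcup_n\mathcal A_{\Lambda_n}$. Write $a^{(x)}=\alpha_x(a)$ for the copy of $a\in\mathcal A$ at the site $x$, and $\alpha_g$ for the shift of $\mathcal A_V$ with $\alpha_g(a^{(x)})=a^{(gx)}$, where $gx$ is the concatenation of words. A tree-homogeneous quantum Markov chain $\varphi\equiv(\phi_o,\mathcal E)$ (with trivial boundary condition) consists of a state $\phi_o$ on $\mathcal A$; a unital completely positive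 map $\mathcal E:\mathcal A_{\{o\}\cup S(o)}\to\mathcal A_o\cong\mathcal A$; the quasi-conditional expectations $E_{\Lambda_n}=\mathrm{id}_{\mathcal A_{\Lambda_{n-1}}}\otimes\bigotimes_{u\in W_n}\alpha_u\mathcal E\alpha_u^{-1}:\mathcal A_{\Lambda_{n+1}}\to\mathcal A_{\Lambda_n}$; and a state $\varphi$ on $\mathcal A_V$ with $\varphi(a)=\lim_n\phi_o(E_{\Lambda_0}\circ\cdots\circ E_{\Lambda_n}(a))$ for local $a$ and $\varphi\circ\alpha_j=\varphi$ for $j=1,\dots,k$. For $a\in\mathcal A_{\Lambda_n}$ put $E_{o]}(a)=E_{\Lambda_0}\circ\cdots\circ E_{\Lambda_n}(a)\in\mathcal A_o\cong\mathcal A$. For $a\in\mathcal A$ put $T(a)=\mathcal E(a^{(o)}\otimes 1_{S(o)})$ and $P^{(j)}(a)=\mathcal E(1\otimes a^{(j)}\otimes 1)$; along a ray with $x_{n+1}=(x_n,j_{n+1})$ let $P_{x_1}^{x_m}=P^{(j_2)}\circ\cdots\circ P^{(j_m)}$ ($m\ge1$; the identity for $m=1$) and $T_{x_m}=T$, all algebras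 $\mathcal A_x$ being identified with $\mathcal A$. For $a,b\in\mathcal A$, $\mathcal E(a\otimes b)$ denotes $\mathcal E(a^{(o)}b^{(x_1)})$, and $\mathcal E(a\otimes 1)=T(a)$. For $a\in\mathcal A$ and local $b$, $a\otimes b$ denotes $\alpha_o(a)\,\alpha_{x_1}(b)$. For a projection $e\in\mathcal A$, $e^\perp=1-e$, and a ray $r$, let $\tau_{e;x_n}=(e^\perp)^{(x_0)}\cdots(e^\perp)^{(x_{n-1})}e^{(x_n)}$ and $\tau_{e;x_n;\infty}=(e^\perp)^{(x_0)}\cdots(e^\perp)^{(x_n)}$. The infinite sums below are evaluated as limits over partial sums. - $e$ is $\mathcal E$-recurrent if $0<\mathrm{Tr}(\mathcal E(e\otimes1))<\infty$ and $\frac{1}{\mathrm{Tr}(\mathcal E(e\otimes 1))}\mathrm{Tr}\big(E_{o]}(\sum_{n\ge0}e\otimes\tau_{e;x_n})\big)=1$ for every ray. - $e$ is $\varphi$-recurrent if $\varphi(\alpha_o(e))\ne0$ and $\frac1{\varphi(\alpha_o(e))}\varphi\big(\sum_{n\ge0}e\otimes\tau_{e;x_n}\big)=1$ for every ray. - A projection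 $f$ is $\mathcal E$-accessible (resp. $\varphi$-accessible) from $e$ if for every ray there is $m\ge1$ with $E_{o]}(\alpha_o(e)\alpha_{x_m}(f))\neq0$ (resp. $\varphi(\alpha_o(e)\alpha_{x_m}(f))\ne0$). **Theorem.** Let $\varphi\equiv(\phi_o,\mathcal E)$ be a tree-homogeneous quantum Markov chain on $\mathcal A_V$ and let $e,f\in\mathcal A$ be projections. (i) $e$ is $\mathcal E$-recurrent if and only if $0<\mathrm{Tr}(\mathcal E(e\otimes1))<\infty$ and, for every ray $r$, $\mathcal E(e\otimes E_{o]}(\tau_{e;r;\infty}))=0$. Here $\mathcal E(e\otimes E_{o]}(\tau_{e;r;\infty}))=0$ means $\lim_n\mathcal E(e\otimes E_{o]}(\tau_{e;x_n;\infty}))=0$ in norm. If moreover $E_{o]}(\tau_{e;r;\infty})=\lim_n E_{o]}(\tau_{e;x_n;\infty})$ exists in $\mathcal A$ for every ray, either in norm, or in the weak operator topology with each map $b\mapsto\mathcal E(e^{(o)}b^{(j)})$ ($1\le j\le k$) normal along decreasing sequences of positive elements of $\mathcal A$, then the equivalence also holds with $\mathcal E(e\otimes E_{o]}(\tau_{e;r;\infty}))$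 read as the value of $\mathcal E$ at $e\otimes E_{o]}(\tau_{e;r;\infty})$. (ii) $e$ is $\varphi$-recurrent if and only if $\varphi(\alpha_o(e))\neq0$ and, for every ray $r$, $\varphi(e\otimes\tau_{e;r;\infty}):=\lim_n\varphi(e\otimes\tau_{e;x_n;\infty})=0$. (iii) $f$ is $\mathcal E$-accessible from $e$ if and only if for every ray there is $m\ge1$ with $\mathcal E(e\otimes P_{x_1}^{x_m}T_{x_m}f)\neq0$. (iv) $f$ is $\varphi$-accessible from $e$ if and only if for every ray there is $m\ge1$ with $\phi_o\big(\mathcal E(e\otimes P_{x_1}^{x_m}T_{x_m}f)\big)\neq0$. -/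

import Mathlib

open scoped ComplexOrder ENNReal Topology lp
open Filter

namespace TreeQMC

noncomputable section

/-- The Hilbert space `ℓ²(S)`. -/
abbrev Hil (S : Type*) : Type _ := lp (fun _ : S => ℂ) 2
/-- `B(ℓ²(S))`. -/
abbrev Op (S : Type*) : Type _ := Hil S →L[ℂ] Hil S

section Instances
/-! Shortcut instances, all equal to the ones found by inference. -/

variable {S : Type*}

instance : NormedAddCommGroup (Hil S) := inferInstance
instance : InnerProductSpace ℂ (Hil S) := inferInstance
instance : CompleteSpace (Hil S) := inferInstance
instance : AddCommMonoid (Hil S) := inferInstance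
instance : Module ℂ (Hil S) := inferInstance
instance : TopologicalSpace (Hil S) := inferInstance

instance : NormedRing (Op S) := inferInstance
instance : Ring (Op S) := inferInstance
instance : Semiring (Op S) := inferInstance
instance : StarRing (Op S) := inferInstance
instance : Algebra ℂ (Op S) := inferInstance
instance : StarModule ℂ (Op S) := inferInstance

variable (𝒞 : StarSubalgebra ℂ (Op S))

instance : Ring 𝒞 := inferInstance
instance : AddCommMonoid 𝒞 := inferInstance
instance : Module ℂ 𝒞 := inferInstance
instance : One 𝒞 := inferInstance
instance : Mul 𝒞 := inferInstance
instance : StarRing 𝒞 := inferInstance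
instance : Star 𝒞 := inferInstance
instance : TopologicalSpace 𝒞 := inferInstance

end Instances

section Amplification
variable {S T C : Type*}

lemma summable_sq (ψ : Hil S) : Summable fun s => ‖ψ s‖ ^ 2 := by
  simpa using (lp.hasSum_norm (p := 2) (by norm_num) ψ).summable

lemma hasSum_sq (ψ : Hil S) : HasSum (fun s => ‖ψ s‖ ^ 2) (‖ψ‖ ^ 2) := by
  simpa using lp.hasSum_norm (p := 2) (by norm_num) ψ

lemma memlp_of_summable {f : S → ℂ} (h : Summable fun s => ‖f s‖ ^ 2) :
    Memℓp (E := fun _ : S => ℂ) f 2 :=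
  memℓp_gen (by simpa using h)

/-- The slice of a vector of `ℓ²(T) ≅ ℓ²(C) ⊗ ℓ²(S)` at the basis element `c` of `ℓ²(C)`. -/
def slice (e : T ≃ C × S) (c : C) : Hil T →ₗ[ℂ] Hil S where
  toFun ψ := ⟨fun s => ψ (e.symm (c, s)), memlp_of_summable
    ((summable_sq ψ).comp_injective
      (i := fun s => e.symm (c, s)) (fun a b h => by simpa using h))⟩
  map_add' _ _ := by ext; simp; rfl
  map_smul' _ _ := by ext; simp

@[simp] lemma slice_apply (e : T ≃ C × S) (c : C) (ψ : Hil T) (s : S) :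
    slice e c ψ s = ψ (e.symm (c, s)) := rfl

lemma hasSum_slice (e : T ≃ C × S) (ψ : Hil T) :
    HasSum (fun c => ‖slice e c ψ‖ ^ 2) (‖ψ‖ ^ 2) := by
  have h := (e.symm.hasSum_iff (f := fun t => ‖ψ t‖ ^ 2)).2 (hasSum_sq ψ)
  exact h.prod_fiberwise fun c => hasSum_sq (slice e c ψ)

lemma summable_amp (e : T ≃ C × S) (A : Op S) (ψ : Hil T) :
    Summable fun c => ‖A (slice e c ψ)‖ ^ 2 := by
  refine Summable.of_nonneg_of_le (fun _ => by positivity) (fun c => ?_)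
    ((hasSum_slice e ψ).summable.mul_left (‖A‖ ^ 2))
  rw [← mul_pow]
  exact pow_le_pow_left₀ (norm_nonneg _) (A.le_opNorm _) 2

lemma amp_mem (e : T ≃ C × S) (A : Op S) (ψ : Hil T) :
    Memℓp (E := fun _ : T => ℂ) (fun t => A (slice e (e t).1 ψ) (e t).2) 2 := by
  refine memlp_of_summable ?_
  rw [← e.symm.summable_iff]
  refine (summable_prod_of_nonneg (fun _ => sq_nonneg _)).2 ⟨fun c => ?_, ?_⟩
  · simpa using summable_sq (A (slice e c ψ))
  · simpa [(hasSum_sq _).tsum_eq] using summable_amp e A ψ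

/-- The linear map underlying `1 ⊗ A`. -/
def ampLin (e : T ≃ C × S) (A : Op S) : Hil T →ₗ[ℂ] Hil T where
  toFun ψ := ⟨fun t => A (slice e (e t).1 ψ) (e t).2, amp_mem e A ψ⟩
  map_add' _ _ := by ext; simp; rfl
  map_smul' _ _ := by ext; simp

lemma slice_ampLin (e : T ≃ C × S) (A : Op S) (ψ : Hil T) (c : C) :
    slice e c (ampLin e A ψ) = A (slice e c ψ) := by
  ext s
  simp [ampLin]

/-- For `T ≃ C × S`, the operator `1 ⊗ A` on `ℓ²(T) ≅ ℓ²(C) ⊗ ℓ²(S)`. -/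
def ampCLM (e : T ≃ C × S) (A : Op S) : Op T :=
  (ampLin e A).mkContinuous ‖A‖ fun ψ => by
    refine le_of_sq_le_sq ?_ (by positivity)
    rw [mul_pow]
    refine hasSum_le (fun c => ?_) (hasSum_slice e (ampLin e A ψ))
      ((hasSum_slice e ψ).mul_left (‖A‖ ^ 2))
    rw [slice_ampLin, ← mul_pow]
    exact pow_le_pow_left₀ (norm_nonneg _) (A.le_opNorm _) 2

@[simp] lemma slice_ampCLM (e : T ≃ C × S) (A : Op S) (ψ : Hil T) (c : C) :
    slice e c (ampCLM e A ψ) = A (slice e c ψ) := slice_ampLin e A ψ c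

lemma ampCLM_apply (e : T ≃ C × S) (A : Op S) (ψ : Hil T) (t : T) :
    ampCLM e A ψ t = A (slice e (e t).1 ψ) (e t).2 := rfl

lemma slice_ext (e : T ≃ C × S) {ψ χ : Hil T} (h : ∀ c, slice e c ψ = slice e c χ) : ψ = χ := by
  ext t
  have := congrArg (fun f : Hil S => f (e t).2) (h (e t).1)
  simpa using this

lemma op_ext (e : T ≃ C × S) {A B : Op T} (h : ∀ ψ c, slice e c (A ψ) = slice e c (B ψ)) : A = B :=
  ContinuousLinearMap.ext fun ψ => slice_ext e (h ψ)

lemma hasSum_inner_slice (e : T ≃ C × S) (ψ χ : Hil T) :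
    HasSum (fun c => inner ℂ (slice e c ψ) (slice e c χ)) (inner ℂ ψ χ) := by
  have h := (e.symm.hasSum_iff (f := fun t => inner ℂ (ψ t) (χ t))).2 (lp.hasSum_inner ψ χ)
  exact h.prod_fiberwise fun c => lp.hasSum_inner (slice e c ψ) (slice e c χ)

lemma ampCLM_norm_le (e : T ≃ C × S) (A : Op S) (ψ : Hil T) :
    ‖ampCLM e A ψ‖ ≤ ‖A‖ * ‖ψ‖ := by
  refine le_of_sq_le_sq ?_ (by positivity)
  rw [mul_pow]
  refine hasSum_le (fun c => ?_) (hasSum_slice e (ampCLM e A ψ))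
    ((hasSum_slice e ψ).mul_left (‖A‖ ^ 2))
  rw [slice_ampCLM, ← mul_pow]
  exact pow_le_pow_left₀ (norm_nonneg _) (A.le_opNorm _) 2

/-- `A ↦ 1 ⊗ A` as a unital `*`-homomorphism `B(ℓ²(S)) → B(ℓ²(T))`. -/
def amp (e : T ≃ C × S) : Op S →⋆ₐ[ℂ] Op T where
  toFun := ampCLM e
  map_one' := op_ext e fun ψ c => by simp
  map_mul' A B := op_ext e fun ψ c => by simp
  map_zero' := op_ext e fun ψ c => by simp
  map_add' A B := op_ext e fun ψ c => by simp
  commutes' r := op_ext e fun ψ c => by simp [Algebra.algebraMap_eq_smul_one]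
  map_star' A := by
    rw [ContinuousLinearMap.star_eq_adjoint, ContinuousLinearMap.star_eq_adjoint]
    refine (ContinuousLinearMap.eq_adjoint_iff _ _).2 fun ψ χ => ?_
    refine (hasSum_inner_slice e _ _).unique ?_
    convert hasSum_inner_slice e ψ (ampCLM e A χ) using 2 with c
    simp [ContinuousLinearMap.adjoint_inner_left]

lemma amp_continuous (e : T ≃ C × S) : Continuous (amp e) :=
  AddMonoidHomClass.continuous_of_bound (amp e) 1 fun A => by
    rw [one_mul]
    exact ContinuousLinearMap.opNorm_le_bound _ (norm_nonneg _) fun ψ =>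
      (ampCLM_norm_le e A ψ)

lemma amp_apply (e : T ≃ C × S) (A : Op S) (ψ : Hil T) (t : T) :
    amp e A ψ t = A (slice e (e t).1 ψ) (e t).2 := rfl

end Amplification

/-- The vertices `(i₁, …, iₙ)` of the semi-infinite Cayley tree of order `k`. The root is `[]`, the
level of a vertex is its length, and the direct successors of `x` are the words `x ++ [j]`. -/
abbrev Vertex (k : ℕ) : Type := List (Fin k)

section QuasiLocal
variable {k : ℕ} {ι : Type*}

/-- `ℓ²(V → ι)`, with configurations split into the site `x` and the other sites. -/
def splitSite (x : Vertex k) : (Vertex k → ι) ≃ ({y : Vertex k // y ≠ x} → ι) × ι :=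
  (Equiv.funSplitAt x ι).trans (Equiv.prodComm _ _)

/-- The copy `A^{(x)} = α_x(A)` of an operator `A` on `ℓ²(ι)` at the site `x`. All the sites act on
the Hilbert space `ℓ²(V → ι)`, the complete infinite tensor product of copies of `ℓ²(ι)`. -/
def site (x : Vertex k) : Op ι →⋆ₐ[ℂ] Op (Vertex k → ι) :=
  amp (splitSite x)

/-- Configurations on `V`, split into their restrictions to `V ∖ gV` and to `gV ≅ V`. -/
def splitShift (k : ℕ) (ι : Type*) (g : Vertex k) :
    (Vertex k → ι) ≃ ({y : Vertex k // ¬ g <+: y} → ι) × (Vertex k → ι) where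
  toFun s := (fun y => s y.1, fun x => s (g ++ x))
  invFun p y := if h : g <+: y then p.2 (y.drop g.length) else p.1 ⟨y, h⟩
  left_inv s := by
    funext y
    by_cases h : g <+: y
    · obtain ⟨z, rfl⟩ := h
      simp
    · simp [h]
  right_inv p := by
    ext y
    · simp [y.2]
    · simp

/-- The shift `α_g`; see `shift_site` for its action on elementary tensors. -/
def shift (g : Vertex k) : Op (Vertex k → ι) →⋆ₐ[ℂ] Op (Vertex k → ι) :=
  amp (splitShift k ι g)

lemma splitSite_symm_apply (x : Vertex k) (c : {y : Vertex k // y ≠ x} → ι) (i : ι)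
    (y : Vertex k) :
    (splitSite x).symm (c, i) y = if h : y = x then i else c ⟨y, h⟩ := by
  by_cases h : y = x
  · subst h; simp [splitSite, Equiv.funSplitAt, Equiv.piSplitAt]
  · simp [splitSite, Equiv.funSplitAt, Equiv.piSplitAt, h]

lemma splitShift_symm_apply (g : Vertex k) (c : {y : Vertex k // ¬ g <+: y} → ι)
    (t : Vertex k → ι) (y : Vertex k) :
    (splitShift k ι g).symm (c, t) y =
      if h : g <+: y then t (y.drop g.length) else c ⟨y, h⟩ := rfl

lemma slice_slice (g x : Vertex k) (s : Vertex k → ι) (ψ : Hil (Vertex k → ι)) :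
    slice (splitSite x) (splitSite x (splitShift k ι g s).2).1
      (slice (splitShift k ι g) (splitShift k ι g s).1 ψ) =
    slice (splitSite (g ++ x)) (splitSite (g ++ x) s).1 ψ := by
  ext i
  rw [slice_apply, slice_apply, slice_apply]
  refine congrArg ψ (funext fun y => ?_)
  rw [splitShift_symm_apply, splitSite_symm_apply, splitSite_symm_apply]
  by_cases h : g <+: y
  · obtain ⟨z, rfl⟩ := h
    by_cases hz : z = x <;> simp [splitShift, splitSite, hz]
  · have hy : y ≠ g ++ x := by rintro rfl; exact h ⟨x, rfl⟩
    simp [splitShift, splitSite, h, hy]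

theorem shift_site (g x : Vertex k) (A : Op ι) :
    shift g (site x A) = site (g ++ x) A := by
  refine ContinuousLinearMap.ext fun ψ => lp.ext (funext fun s => ?_)
  rw [shift, amp_apply, site, amp_apply, site, amp_apply, ← slice_slice]
  rfl

/-- `𝒜_Λ`, the C*-algebra generated by the copies of `𝒜` at the sites of `Λ`. For finite `Λ` it is
the spatial tensor product of these copies, tensored with the unit on the other sites. -/
def region (𝒜 : StarSubalgebra ℂ (Op ι)) (Λ : Set (Vertex k)) :
    StarSubalgebra ℂ (Op (Vertex k → ι)) :=
  (StarAlgebra.adjoin ℂ (⋃ x ∈ Λ, site x '' (𝒜 : Set (Op ι)))).topologicalClosure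

theorem site_mem_region {𝒜 : StarSubalgebra ℂ (Op ι)} {Λ : Set (Vertex k)} {x : Vertex k}
    (hx : x ∈ Λ) {a : Op ι} (ha : a ∈ 𝒜) : site x a ∈ region 𝒜 Λ :=
  StarSubalgebra.le_topologicalClosure _
    (StarAlgebra.subset_adjoin ℂ _ (Set.mem_biUnion hx ⟨a, ha, rfl⟩))

theorem shift_mem_region {𝒜 : StarSubalgebra ℂ (Op ι)} {Λ Λ' : Set (Vertex k)} {g : Vertex k}
    (hg : ∀ x ∈ Λ, g ++ x ∈ Λ') {a : Op (Vertex k → ι)} (ha : a ∈ region 𝒜 Λ) :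
    shift g a ∈ region 𝒜 Λ' := by
  have hgen : ∀ b ∈ StarAlgebra.adjoin ℂ (⋃ x ∈ Λ, site x '' (𝒜 : Set (Op ι))),
      shift g b ∈ region 𝒜 Λ' := by
    intro b hb
    induction hb using StarAlgebra.adjoin_induction with
    | mem b hb =>
      simp only [Set.mem_iUnion] at hb
      obtain ⟨x, hx, c, hc, rfl⟩ := hb
      rw [shift_site]
      exact site_mem_region (hg x hx) hc
    | algebraMap r => rw [AlgHomClass.commutes]; exact algebraMap_mem _ r
    | add b c _ _ hb hc => rw [map_add]; exact add_mem hb hc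
    | mul b c _ _ hb hc => rw [map_mul]; exact mul_mem hb hc
    | star b _ hb => rw [map_star]; exact star_mem hb
  have hcl : IsClosed (region 𝒜 Λ' : Set (Op (Vertex k → ι))) :=
    StarSubalgebra.isClosed_topologicalClosure _
  rw [region, ← SetLike.mem_coe, StarSubalgebra.topologicalClosure_coe] at ha
  have := map_mem_closure (amp_continuous (splitShift k ι g)) ha hgen
  rwa [hcl.closure_eq] at this

theorem region_mono {𝒜 : StarSubalgebra ℂ (Op ι)} {Λ Λ' : Set (Vertex k)} (h : Λ ⊆ Λ') :
    region 𝒜 Λ ≤ region 𝒜 Λ' :=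
  StarSubalgebra.topologicalClosure_mono
    (StarAlgebra.adjoin_mono (Set.biUnion_subset_biUnion_left h))

/-- `Λ_n`, the set of vertices at distance at most `n` from the root. -/
def ball (k n : ℕ) : Set (Vertex k) := {x | x.length ≤ n}

/-- `W_n`, the vertices at distance `n` from the root, listed in lexicographic order. -/
def level (k : ℕ) : ℕ → List (Vertex k)
  | 0 => [[]]
  | n + 1 => (level k n).flatMap fun u => (List.finRange k).map fun j => u ++ [j]

theorem ball_mono {m n : ℕ} (h : m ≤ n) : ball k m ⊆ ball k n := fun _ hx => le_trans hx h

/-- The quasi-local algebra `𝒜_V`. -/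
abbrev quasiLocal (k : ℕ) (𝒜 : StarSubalgebra ℂ (Op ι)) : StarSubalgebra ℂ (Op (Vertex k → ι)) :=
  region 𝒜 Set.univ

/-- The local algebra `𝒜_{V,loc} = ⋃ₙ 𝒜_{Λ_n}`. -/
def localAlg (k : ℕ) (𝒜 : StarSubalgebra ℂ (Op ι)) : StarSubalgebra ℂ (Op (Vertex k → ι)) where
  carrier := {a | ∃ n, a ∈ region 𝒜 (ball k n)}
  mul_mem' := by
    rintro a b ⟨m, hm⟩ ⟨n, hn⟩
    exact ⟨max m n, mul_mem (region_mono (ball_mono (le_max_left m n)) hm)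
      (region_mono (ball_mono (le_max_right m n)) hn)⟩
  add_mem' := by
    rintro a b ⟨m, hm⟩ ⟨n, hn⟩
    exact ⟨max m n, add_mem (region_mono (ball_mono (le_max_left m n)) hm)
      (region_mono (ball_mono (le_max_right m n)) hn)⟩
  algebraMap_mem' r := ⟨0, algebraMap_mem _ r⟩
  star_mem' := by
    rintro a ⟨m, hm⟩
    exact ⟨m, star_mem hm⟩

theorem localAlg_le (𝒜 : StarSubalgebra ℂ (Op ι)) : localAlg k 𝒜 ≤ quasiLocal k 𝒜 := by
  rintro a ⟨n, hn⟩
  exact region_mono (Set.subset_univ _) hn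

/-- The copy `a^{(x)}` of `a ∈ 𝒜` at the site `x`, as a local observable. -/
def siteLoc {𝒜 : StarSubalgebra ℂ (Op ι)} (x : Vertex k) (a : 𝒜) : localAlg k 𝒜 :=
  ⟨site x (a : Op ι), x.length, site_mem_region (le_refl x.length) a.2⟩

/-- The shift `α_g` on local observables. -/
def shiftLoc {𝒜 : StarSubalgebra ℂ (Op ι)} (g : Vertex k) (a : localAlg k 𝒜) : localAlg k 𝒜 :=
  ⟨shift g (a : Op (Vertex k → ι)), by
    obtain ⟨n, hn⟩ := a.2
    refine ⟨g.length + n, shift_mem_region (fun x hx => ?_) hn⟩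
    have : x.length ≤ n := hx
    show (g ++ x).length ≤ g.length + n
    simpa using this⟩

/-- The shift `α_g : 𝒜_V → 𝒜_V`. -/
def shiftV {𝒜 : StarSubalgebra ℂ (Op ι)} (g : Vertex k) (a : quasiLocal k 𝒜) : quasiLocal k 𝒜 :=
  ⟨shift g (a : Op (Vertex k → ι)), shift_mem_region (fun _ _ => Set.mem_univ _) a.2⟩

/-- The element `a^{(o)} ⊗ b^{((j))}` of `𝒜_{{o} ∪ S(o)}`, with the unit at the other successors
of the root. -/
def pairTensor {𝒜 : StarSubalgebra ℂ (Op ι)} (a : 𝒜) (j : Fin k) (b : 𝒜) :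
    region 𝒜 (ball k 1) :=
  ⟨site [] (a : Op ι) * site [j] (b : Op ι),
    mul_mem (site_mem_region (show ([] : Vertex k).length ≤ 1 by simp) a.2)
      (site_mem_region (show [j].length ≤ 1 by simp) b.2)⟩

/-- The element `a^{(o)} ⊗ 1_{S(o)}` of `𝒜_{{o} ∪ S(o)}`. -/
def rootTensor (k : ℕ) {𝒜 : StarSubalgebra ℂ (Op ι)} (a : 𝒜) : region 𝒜 (ball k 1) :=
  ⟨site [] (a : Op ι), site_mem_region (show ([] : Vertex k).length ≤ 1 by simp) a.2⟩

end QuasiLocal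
/-- Complete positivity of a linear map between `*`-algebras of operators: every matrix
`(Φ(aᵢ* aⱼ))ᵢⱼ` is positive. -/
def IsCompletelyPositive {S T : Type*} {𝒞 : StarSubalgebra ℂ (Op S)} {𝒟 : StarSubalgebra ℂ (Op T)}
    (Φ : 𝒞 →ₗ[ℂ] 𝒟) : Prop :=
  ∀ (n : ℕ) (a : Fin n → 𝒞) (v : Fin n → Hil T),
    0 ≤ ∑ i, ∑ j, inner ℂ (v i) ((Φ (star (a i) * a j) : Op T) (v j))

/-- A completely positive identity preserving linear map. -/
structure IsMarkov {S T : Type*} {𝒞 : StarSubalgebra ℂ (Op S)} {𝒟 : StarSubalgebra ℂ (Op T)}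
    (Φ : 𝒞 →ₗ[ℂ] 𝒟) : Prop where
  cp : IsCompletelyPositive Φ
  map_one : Φ 1 = 1

/-- A state: a positive normalized linear functional. -/
structure IsState {S : Type*} {𝒞 : StarSubalgebra ℂ (Op S)} (ω : 𝒞 →ₗ[ℂ] ℂ) : Prop where
  nonneg : ∀ a, 0 ≤ ω (star a * a)
  map_one : ω 1 = 1

section Chain
variable {k : ℕ} {ι : Type*} {𝒜 : StarSubalgebra ℂ (Op ι)}

/-- The composition `𝓔 ∘ E_{Λ_1} ∘ ⋯ ∘ E_{Λ_n} : 𝒜_{Λ_{n+1}} → 𝒜`. -/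
def iterCond (𝓔 : region 𝒜 (ball k 1) →ₗ[ℂ] 𝒜)
    (E : ∀ n, region 𝒜 (ball k (n + 1)) →ₗ[ℂ] region 𝒜 (ball k n)) :
    ∀ n, region 𝒜 (ball k (n + 1)) →ₗ[ℂ] 𝒜
  | 0 => 𝓔
  | n + 1 => iterCond 𝓔 E n ∘ₗ E (n + 1)

/-- A tree-homogeneous quantum Markov chain `φ ≡ (φ_o, 𝓔)` on `𝒜_V`, with trivial boundary
condition. -/
structure TreeHomogeneousQMC (k : ℕ) {ι : Type*} (𝒜 : StarSubalgebra ℂ (Op ι)) where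
  /-- the initial state `φ_o` -/
  initial : 𝒜 →ₗ[ℂ] ℂ
  initial_state : IsState initial
  /-- the Markov transition expectation `𝓔` from `𝒜_{{o} ∪ S(o)}` into `𝒜_o ≅ 𝒜` -/
  trans : region 𝒜 (ball k 1) →ₗ[ℂ] 𝒜
  trans_markov : IsMarkov trans
  /-- the quasi-conditional expectation `E_{Λ_n}` with respect to the triple
  `𝒜_{Λ_{n-1}} ⊆ 𝒜_{Λ_n} ⊆ 𝒜_{Λ_{n+1}}` -/
  cond : ∀ n, region 𝒜 (ball k (n + 1)) →ₗ[ℂ] region 𝒜 (ball k n)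
  cond_markov : ∀ n, IsMarkov (cond n)
  cond_module : ∀ (n : ℕ) (c a : region 𝒜 (ball k (n + 1))),
    (c : Op (Vertex k → ι)) ∈ region 𝒜 {x : Vertex k | x.length < n} →
      (cond n (c * a) : Op (Vertex k → ι)) = c * cond n a
  /-- `E_{Λ_n} = id_{Λ_{n-1}} ⊗ 𝓔_{W_n}`, where `𝓔_{W_n}` is the tensor product over `u ∈ W_n` of
  the shifts `𝓔_u = α_u ∘ 𝓔 ∘ α_u⁻¹` -/
  cond_tensor : ∀ (n : ℕ) (c : Op (Vertex k → ι)) (b : Vertex k → region 𝒜 (ball k 1))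
    (a : region 𝒜 (ball k (n + 1))), c ∈ region 𝒜 {x : Vertex k | x.length < n} →
      (a : Op (Vertex k → ι)) =
        c * ((level k n).map fun u => shift u (b u : Op (Vertex k → ι))).prod →
      (cond n a : Op (Vertex k → ι)) =
        c * ((level k n).map fun u => site u (trans (b u) : Op ι)).prod
  /-- the state `φ` on `𝒜_V` -/
  state : quasiLocal k 𝒜 →ₗ[ℂ] ℂ
  state_state : IsState state
  state_limit : ∀ (m : ℕ) (a : Op (Vertex k → ι)) (ha : a ∈ region 𝒜 (ball k m)),
    Tendsto (fun n : ℕ => initial (iterCond trans cond (m + n)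
      ⟨a, region_mono (ball_mono (show m ≤ m + n + 1 by omega)) ha⟩)) atTop
      (𝓝 (state ⟨a, region_mono (Set.subset_univ _) ha⟩))
  homogeneous : ∀ (j : Fin k) (a : quasiLocal k 𝒜), state (shiftV [j] a) = state a

/-- The standard trace `∑ᵢ ⟨δᵢ, a δᵢ⟩ ∈ [0, ∞]` of a positive operator `a` on `ℓ²(ι)`. -/
def posTrace (a : Op ι) : ℝ≥0∞ := by
  classical exact ∑' i, ENNReal.ofReal ((a (lp.single 2 i (1 : ℂ))) i).re

/-- A ray `o = x_0 ∼ x_1 ∼ x_2 ∼ ⋯` with `x_{n+1} ∈ S(x_n)`, given by its coordinates: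
`x_n = (r 0, …, r (n-1))`. -/
abbrev Ray (k : ℕ) : Type := ℕ → Fin k

/-- The vertex `x_n` of a ray. -/
def vertex (r : Ray k) (n : ℕ) : Vertex k := (List.range n).map r

/-- `τ_{e;x_n}`: the projection `e` at `x_n` and `e^⊥` at `x_0, …, x_{n-1}`. -/
def tau (r : Ray k) (e : 𝒜) (n : ℕ) : localAlg k 𝒜 :=
  ((List.range n).map fun m => siteLoc (vertex r m) (1 - e)).prod * siteLoc (vertex r n) e

/-- `τ_{e;x_n;∞}`: the projection `e^⊥` at `x_0, …, x_n`. -/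
def tauInf (r : Ray k) (e : 𝒜) (n : ℕ) : localAlg k 𝒜 :=
  ((List.range (n + 1)).map fun m => siteLoc (vertex r m) (1 - e)).prod

/-- `e ⊗ a = α_o(e) α_{x_1}(a)` for `e ∈ 𝒜` and a local observable `a`. -/
def rootTensorShift (r : Ray k) (e : 𝒜) (a : localAlg k 𝒜) : localAlg k 𝒜 :=
  siteLoc [] e * shiftLoc (vertex r 1) a

namespace TreeHomogeneousQMC
variable (Q : TreeHomogeneousQMC k 𝒜)

open Classical in
/-- The conditional expectation `E_{o]}`, on the local algebra:
`E_{o]}(a) = 𝓔(E_{Λ_1}(⋯ E_{Λ_n}(a)))` for `a ∈ 𝒜_{Λ_n}`. -/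
def Eo (a : localAlg k 𝒜) : 𝒜 :=
  iterCond Q.trans Q.cond (Nat.find a.2)
    ⟨a, region_mono (ball_mono (Nat.le_succ _)) (Nat.find_spec a.2)⟩

/-- The value of `φ` on a local observable. -/
def stateLoc (a : localAlg k 𝒜) : ℂ := Q.state ⟨a, localAlg_le 𝒜 a.2⟩

/-- The forward Markov operator `T(a) = 𝓔(a ⊗ 1)`; `T_u` is its copy under `𝒜_u ≅ 𝒜`. -/
def T (a : 𝒜) : 𝒜 := Q.trans (rootTensor k a)

/-- The backward Markov operator `P^{(j)}(a) = 𝓔(1 ⊗ a^{((j))} ⊗ 1)`; `P_u^{(u,j)}` is its copy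
under `𝒜_u ≅ 𝒜 ≅ 𝒜_{(u,j)}`. -/
def P (j : Fin k) (a : 𝒜) : 𝒜 := Q.trans (pairTensor 1 j a)

/-- `P_{x_n}^{x_{n+m}} = P_{x_n}^{x_{n+1}} ∘ ⋯ ∘ P_{x_{n+m-1}}^{x_{n+m}}` along a ray. -/
def Pray (r : Ray k) (n : ℕ) : ℕ → 𝒜 → 𝒜
  | 0 => id
  | m + 1 => Pray r n m ∘ Q.P (r (n + m))

/-- `0 < Tr(𝓔(e ⊗ 1)) < ∞`. -/
def TraceNondegenerate (e : 𝒜) : Prop :=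
  0 < posTrace (Q.trans (rootTensor k e) : Op ι) ∧ posTrace (Q.trans (rootTensor k e) : Op ι) < ⊤

/-- `𝓔`-recurrence; the infinite series is evaluated through its partial sums. -/
def ERecurrent (e : 𝒜) : Prop :=
  Q.TraceNondegenerate e ∧ ∀ r : Ray k,
    Tendsto (fun N : ℕ => (posTrace (Q.trans (rootTensor k e) : Op ι))⁻¹ *
        posTrace (Q.Eo (∑ n ∈ Finset.range N, rootTensorShift r e (tau r e n)) : Op ι))
      atTop (𝓝 1)

/-- `φ`-recurrence; the infinite series is evaluated through its partial sums. -/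
def PhiRecurrent (e : 𝒜) : Prop :=
  Q.stateLoc (siteLoc [] e) ≠ 0 ∧ ∀ r : Ray k,
    Tendsto (fun N : ℕ => (Q.stateLoc (siteLoc [] e))⁻¹ *
        Q.stateLoc (∑ n ∈ Finset.range N, rootTensorShift r e (tau r e n)))
      atTop (𝓝 1)

/-- `f` is `𝓔`-accessible from `e`. -/
def EAccessible (e f : 𝒜) : Prop :=
  ∀ r : Ray k, ∃ m : ℕ, 1 ≤ m ∧ Q.Eo (siteLoc [] e * siteLoc (vertex r m) f) ≠ 0

/-- `f` is `φ`-accessible from `e`. -/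
def PhiAccessible (e f : 𝒜) : Prop :=
  ∀ r : Ray k, ∃ m : ℕ, 1 ≤ m ∧ Q.stateLoc (siteLoc [] e * siteLoc (vertex r m) f) ≠ 0

end TreeHomogeneousQMC

/-- Convergence of a sequence of operators in the weak operator topology. -/
def WeakTendsto (b : ℕ → Op ι) (B : Op ι) : Prop :=
  ∀ v w : Hil ι, Tendsto (fun n => inner ℂ v (b n w)) atTop (𝓝 (inner ℂ v (B w)))

/-- Normality of a map along decreasing sequences of positive operators. -/
def IsSeqNormal (Ψ : 𝒜 → 𝒜) : Prop :=
  ∀ (b : ℕ → 𝒜) (B : 𝒜), (∀ n, (0 : Op ι) ≤ b n) → (∀ n, (b (n + 1) : Op ι) ≤ b n) →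
    WeakTendsto (fun n => (b n : Op ι)) B → WeakTendsto (fun n => (Ψ (b n) : Op ι)) (Ψ B)

end Chain

end

end TreeQMC

open TreeQMC

/-! With `X = T(e)` and `Y n = 𝓔(e ⊗ E_{o]}(τ_{e;x_n;∞}))`, everything about recurrence comes from a
telescoping identity. Each `τ_{e;x_n}` is the difference of two consecutive products of copies of `1
- e`, so the sum over `n ≤ N` is `1 - τ_{e;x_N;∞}` (`sum_tau_eq`), and `E_{o]}` maps the `N`-th
partial sum of the recurrence series to `X - Y N`. For (i), `0 ≤ Y n ≤ X` with `0 < Tr X < ∞`, so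
the normalized trace tends to 1 iff `Tr (Y n) → 0`. A positive operator has norm at most its trace
(`norm_le_posTrace`), so trace convergence gives norm convergence. Conversely, even weak convergence
gives trace convergence, by dominated convergence of the diagonal entries (`tendsto_posTrace_zero`).
Hence trace, norm and weak convergence to 0 agree for `Y`. Moving the limit inside `𝓔(e ⊗ ·)` uses a
positivity bound for norm limits and normality for weak limits. For (ii), `φ = φ_o ∘ E_{o]}` on
local observables (`stateLoc_eq`), and the telescoping identity with linearity is enough. The
algebraic core is `Eo_path`: `E_{o]}` of a product along a ray is a nested transition `𝓔(a₀ ⊗ 𝓔(a₁ ⊗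
⋯))`, because `𝓔` is unital and the sites off the ray contribute 1. Taking `e, 1, …, 1, f` along the
ray gives (iii) and (iv). -/

namespace TreeQMC

noncomputable section

/-! ### Positive operators, the trace and modes of convergence -/

section Operators

variable {S : Type*}

lemma op_nonneg_iff (A : Op S) : 0 ≤ A ↔ ∀ v, 0 ≤ inner ℂ v (A v) := by
  rw [ContinuousLinearMap.nonneg_iff_isPositive]
  refine ⟨fun h v => h.inner_nonneg_right v, fun h => ?_⟩
  rw [ContinuousLinearMap.isPositive_iff_complex]
  intro v
  have hv := Complex.nonneg_iff.1 (h v)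
  have hc : inner ℂ (A v) v = inner ℂ v (A v) := by
    rw [← inner_conj_symm, Complex.conj_eq_iff_im]
    exact hv.2.symm
  rw [hc]
  exact ⟨Complex.ext rfl hv.2, hv.1⟩

/-- The functional calculus of an element of a norm-closed `*`-subalgebra stays inside it. This is
where closedness of `𝒜` enters the argument. -/
lemma exists_isSelfAdjoint_mul_self_eq {H : Type*} [NormedAddCommGroup H] [InnerProductSpace ℂ H]
    [CompleteSpace H] {s : StarSubalgebra ℂ (H →L[ℂ] H)} (hs : IsClosed (s : Set (H →L[ℂ] H)))
    {a : H →L[ℂ] H} (has : a ∈ s) (ha : 0 ≤ a) : ∃ c ∈ s, star c = c ∧ c * c = a := by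
  refine ⟨CFC.sqrt a, ?_, (CFC.sqrt_nonneg a).isSelfAdjoint.star_eq, CFC.sqrt_mul_sqrt_self a ha⟩
  rw [CFC.sqrt, cfcₙ_nnreal_eq_real _ a ha]
  exact cfcₙ_mem (𝕜 := ℝ) (𝕜' := ℂ) (hs := hs) _ has

lemma norm_le_norm_of_nonneg_of_le {H : Type*} [NormedAddCommGroup H] [InnerProductSpace ℂ H]
    [CompleteSpace H] {a b : H →L[ℂ] H} (ha : 0 ≤ a) (hab : a ≤ b) : ‖a‖ ≤ ‖b‖ :=
  CStarAlgebra.norm_le_norm_of_nonneg_of_le ha hab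

lemma le_norm_smul_one {H : Type*} [NormedAddCommGroup H] [InnerProductSpace ℂ H]
    [CompleteSpace H] {a : H →L[ℂ] H} (ha : 0 ≤ a) : a ≤ (‖a‖ : ℂ) • (1 : H →L[ℂ] H) := by
  have h := IsSelfAdjoint.le_algebraMap_norm_self (.of_nonneg ha)
  rwa [Algebra.algebraMap_eq_smul_one, ← Complex.coe_smul] at h

lemma exists_star_mul_self_eq {𝒜 : StarSubalgebra ℂ (Op S)} (h𝒜 : IsClosed (𝒜 : Set (Op S)))
    {a : 𝒜} (ha : (0 : Op S) ≤ a) : ∃ c : 𝒜, star c * c = a := by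
  obtain ⟨c, hc, hstar, hmul⟩ := exists_isSelfAdjoint_mul_self_eq h𝒜 a.2 ha
  refine ⟨⟨c, hc⟩, Subtype.ext ?_⟩
  change star c * c = a
  rw [hstar, hmul]

open Classical in
lemma posTrace_eq_tsum_inner (A : Op S) :
    posTrace A = ∑' i, ENNReal.ofReal
      (inner ℂ (lp.single 2 i (1 : ℂ) : Hil S) (A (lp.single 2 i (1 : ℂ)))).re := by
  simp only [posTrace]
  refine tsum_congr fun i => ?_
  rw [lp.inner_single_left]
  simp

lemma posTrace_add {A B : Op S} (hA : 0 ≤ A) (hB : 0 ≤ B) :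
    posTrace (A + B) = posTrace A + posTrace B := by
  classical
  simp only [posTrace_eq_tsum_inner]
  rw [← ENNReal.tsum_add]
  refine tsum_congr fun i => ?_
  rw [add_apply, inner_add_right, Complex.add_re, ENNReal.ofReal_add]
  · exact (Complex.nonneg_iff.1 ((op_nonneg_iff A).1 hA _)).1
  · exact (Complex.nonneg_iff.1 ((op_nonneg_iff B).1 hB _)).1

/-- Write `A = C* C` with `C` self-adjoint: the trace is the squared Hilbert–Schmidt norm of `C`,
which dominates `‖C‖² = ‖A‖`. -/
lemma norm_le_posTrace {A : Op S} (hA : 0 ≤ A) : ENNReal.ofReal ‖A‖ ≤ posTrace A := by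
  classical
  obtain ⟨C, hC, rfl⟩ : ∃ C : Op S, star C = C ∧ star C * C = A := by
    obtain ⟨C, -, hC, hmul⟩ :=
      exists_isSelfAdjoint_mul_self_eq (s := ⊤) isClosed_univ (StarSubalgebra.mem_top (R := ℂ)) hA
    exact ⟨C, hC, by rw [hC, hmul]⟩
  have hdiag : ∀ v : Hil S, inner ℂ v ((star C * C) v) = ((‖C v‖ ^ 2 : ℝ) : ℂ) := fun v => by
    rw [mul_apply_eq_comp, ContinuousLinearMap.star_eq_adjoint,
      ContinuousLinearMap.adjoint_inner_right, inner_self_eq_norm_sq_to_K]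
    simp
  rw [posTrace_eq_tsum_inner]
  simp only [hdiag, Complex.ofReal_re]
  by_cases htop : ∑' i, ENNReal.ofReal (‖C (lp.single 2 i (1 : ℂ))‖ ^ 2) = ⊤
  · rw [htop]; exact le_top
  have hsum : Summable fun i => ‖C (lp.single 2 i (1 : ℂ))‖ ^ 2 := by
    refine (ENNReal.summable_toReal htop).congr fun i => ?_
    rw [ENNReal.toReal_ofReal (by positivity)]
  rw [← ENNReal.ofReal_tsum_of_nonneg (fun _ => by positivity) hsum]
  refine ENNReal.ofReal_le_ofReal ?_
  rw [CStarRing.norm_star_mul_self, ← sq]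
  set t := ∑' i, ‖C (lp.single 2 i (1 : ℂ))‖ ^ 2 with ht
  have ht0 : 0 ≤ t := tsum_nonneg fun _ => by positivity
  have hb : ‖C‖ ≤ Real.sqrt t := by
    refine ContinuousLinearMap.opNorm_le_bound _ (Real.sqrt_nonneg _) fun v => ?_
    refine le_of_sq_le_sq ?_ (by positivity)
    rw [mul_pow, Real.sq_sqrt ht0]
    refine hasSum_le (fun i => ?_) (hasSum_sq (C v)) (hsum.hasSum.mul_right (‖v‖ ^ 2))
    -- Self-adjointness of `C` turns its `i`-th coordinate into an inner product with the column `C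
    -- δᵢ`, ready for Cauchy–Schwarz.
    have hi : C v i = inner ℂ (C (lp.single 2 i (1 : ℂ))) v := by
      rw [← ContinuousLinearMap.adjoint_inner_right, ← ContinuousLinearMap.star_eq_adjoint, hC,
        lp.inner_single_left]
      simp
    rw [hi, ← mul_pow]
    exact pow_le_pow_left₀ (norm_nonneg _) (norm_inner_le_norm _ _) 2
  calc ‖C‖ ^ 2 ≤ Real.sqrt t ^ 2 := pow_le_pow_left₀ (norm_nonneg _) hb 2
    _ = t := Real.sq_sqrt ht0

/-- The trace is an integral of diagonal entries against counting measure; those of `Y n` tend to 0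
and are dominated by those of `X`, which are summable. -/
lemma tendsto_posTrace_zero {X : Op S} (hX : posTrace X < ⊤) {Y : ℕ → Op S}
    (hYX : ∀ n, Y n ≤ X) (hY : WeakTendsto Y 0) :
    Tendsto (fun n => posTrace (Y n)) atTop (𝓝 0) := by
  classical
  let _ : MeasurableSpace S := ⊤
  simp only [posTrace_eq_tsum_inner, ← MeasureTheory.lintegral_count] at hX ⊢
  have key := MeasureTheory.tendsto_lintegral_of_dominated_convergence
    (μ := MeasureTheory.Measure.count) (f := fun _ : S => (0 : ℝ≥0∞))
    (F := fun n i => ENNReal.ofReal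
      (inner ℂ (lp.single 2 i (1 : ℂ) : Hil S) (Y n (lp.single 2 i (1 : ℂ)))).re) _
    (fun n => measurable_from_top)
    (fun n => Eventually.of_forall fun i => ENNReal.ofReal_le_ofReal ?_) hX.ne
    (Eventually.of_forall fun i => ?_)
  · simpa using key
  · have h := (Complex.nonneg_iff.1 ((op_nonneg_iff (X - Y n)).1 (sub_nonneg.2 (hYX n))
      (lp.single 2 i (1 : ℂ)))).1
    rw [sub_apply, inner_sub_right, Complex.sub_re] at h
    linarith
  · have h := hY (lp.single 2 i (1 : ℂ)) (lp.single 2 i (1 : ℂ))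
    have h2 := ENNReal.tendsto_ofReal ((Complex.continuous_re.tendsto _).comp h)
    simpa using h2

lemma weakTendsto_of_tendsto {Y : ℕ → Op S} {B : Op S} (h : Tendsto Y atTop (𝓝 B)) :
    WeakTendsto Y B := fun v w => by
  have hc : Continuous fun A : Op S => inner ℂ v (A w) := by fun_prop
  exact (hc.tendsto B).comp h

lemma WeakTendsto.unique {Y : ℕ → Op S} {A B : Op S} (hA : WeakTendsto Y A)
    (hB : WeakTendsto Y B) : A = B :=
  ContinuousLinearMap.ext fun w => ext_inner_left ℂ fun v => tendsto_nhds_unique (hA v w) (hB v w)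

lemma tendsto_zero_of_tendsto_posTrace_zero {Y : ℕ → Op S} (hY0 : ∀ n, 0 ≤ Y n)
    (h : Tendsto (fun n => posTrace (Y n)) atTop (𝓝 0)) : Tendsto Y atTop (𝓝 0) := by
  have h1 : Tendsto (fun n => ENNReal.ofReal ‖Y n‖) atTop (𝓝 0) :=
    tendsto_of_tendsto_of_tendsto_of_le_of_le tendsto_const_nhds h (fun _ => zero_le)
      fun n => norm_le_posTrace (hY0 n)
  have h2 := (ENNReal.tendsto_toReal ENNReal.zero_ne_top).comp h1
  rw [tendsto_zero_iff_norm_tendsto_zero]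
  simpa [Function.comp_def] using h2

/-- Additivity gives `Tr X = Tr (X - Y n) + Tr (Y n)`. All three terms are finite, so truncated
subtraction in `ℝ≥0∞` behaves as genuine subtraction. -/
lemma tendsto_normalized_posTrace_iff {X : Op S} (h0 : 0 < posTrace X) (hX : posTrace X < ⊤)
    {Y : ℕ → Op S} (hY0 : ∀ n, 0 ≤ Y n) (hYX : ∀ n, Y n ≤ X) :
    Tendsto (fun n => (posTrace X)⁻¹ * posTrace (X - Y n)) atTop (𝓝 1) ↔
      Tendsto (fun n => posTrace (Y n)) atTop (𝓝 0) := by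
  have hadd : ∀ n, posTrace X = posTrace (X - Y n) + posTrace (Y n) := fun n => by
    rw [← posTrace_add (sub_nonneg.2 (hYX n)) (hY0 n), sub_add_cancel]
  have hle : ∀ n, posTrace (X - Y n) ≤ posTrace X := fun n => by rw [hadd n]; exact le_self_add
  have hle' : ∀ n, posTrace (Y n) ≤ posTrace X := fun n => by rw [hadd n]; exact le_add_self
  constructor
  · intro h
    have h1 := ENNReal.Tendsto.const_mul (a := posTrace X) h (Or.inr hX.ne)
    simp only [← mul_assoc, ENNReal.mul_inv_cancel h0.ne' hX.ne, one_mul, mul_one] at h1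
    have h2 := ENNReal.Tendsto.sub (tendsto_const_nhds (x := posTrace X)) h1 (Or.inl hX.ne)
    rw [tsub_self] at h2
    refine h2.congr fun n => ?_
    conv_lhs => rw [hadd n]
    exact ENNReal.add_sub_cancel_left ((hle n).trans_lt hX).ne
  · intro h
    have h2 := ENNReal.Tendsto.sub (tendsto_const_nhds (x := posTrace X)) h (Or.inl hX.ne)
    rw [tsub_zero] at h2
    have h3 := ENNReal.Tendsto.const_mul (a := (posTrace X)⁻¹) h2
      (Or.inr (ENNReal.inv_ne_top.2 h0.ne'))
    rw [ENNReal.inv_mul_cancel h0.ne' hX.ne] at h3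
    refine h3.congr fun n => ?_
    conv_lhs => rw [hadd n, ENNReal.add_sub_cancel_right ((hle' n).trans_lt hX).ne, ← hadd n]

lemma tendsto_normalized_posTrace_iff_weakTendsto {X : Op S} (h0 : 0 < posTrace X)
    (hX : posTrace X < ⊤) {Y : ℕ → Op S} (hY0 : ∀ n, 0 ≤ Y n) (hYX : ∀ n, Y n ≤ X) :
    Tendsto (fun n => (posTrace X)⁻¹ * posTrace (X - Y n)) atTop (𝓝 1) ↔ WeakTendsto Y 0 :=
  (tendsto_normalized_posTrace_iff h0 hX hY0 hYX).trans
    ⟨fun h => weakTendsto_of_tendsto (tendsto_zero_of_tendsto_posTrace_zero hY0 h),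
      tendsto_posTrace_zero hX hYX⟩

lemma tendsto_normalized_posTrace_iff_tendsto {X : Op S} (h0 : 0 < posTrace X)
    (hX : posTrace X < ⊤) {Y : ℕ → Op S} (hY0 : ∀ n, 0 ≤ Y n) (hYX : ∀ n, Y n ≤ X) :
    Tendsto (fun n => (posTrace X)⁻¹ * posTrace (X - Y n)) atTop (𝓝 1) ↔
      Tendsto Y atTop (𝓝 0) :=
  (tendsto_normalized_posTrace_iff h0 hX hY0 hYX).trans
    ⟨tendsto_zero_of_tendsto_posTrace_zero hY0,
      fun h => tendsto_posTrace_zero hX hYX (weakTendsto_of_tendsto h)⟩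

end Operators

/-! ### Matrix entries of site operators and commutation -/

section Commutation

variable {k : ℕ} {ι : Type*}

open Classical in
lemma site_single (x : Vertex k) (A : Op ι) (s t : Vertex k → ι) :
    site x A (lp.single 2 s (1 : ℂ)) t =
      if ∀ z, z ≠ x → t z = s z then A (lp.single 2 (s x) (1 : ℂ)) (t x) else 0 := by
  rw [site, amp_apply]
  have hsl : slice (splitSite x) (splitSite x t).1 (lp.single 2 s (1 : ℂ)) =
      if ∀ z, z ≠ x → t z = s z then lp.single 2 (s x) (1 : ℂ) else 0 := by
    ext i
    rw [slice_apply, lp.single_apply, Pi.single_apply]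
    have hiff : (splitSite x).symm ((splitSite x t).1, i) = s ↔
        (∀ z, z ≠ x → t z = s z) ∧ i = s x := by
      rw [funext_iff]
      simp only [splitSite_symm_apply]
      constructor
      · intro h
        exact ⟨fun z hz => by simpa [hz, splitSite] using h z, by simpa using h x⟩
      · rintro ⟨h, rfl⟩ z
        by_cases hz : z = x
        · simp [hz]
        · simpa [hz, splitSite] using h z hz
    by_cases h : ∀ z, z ≠ x → t z = s z
    · by_cases hi : i = s x
      · rw [if_pos (hiff.2 ⟨h, hi⟩), if_pos h, hi]; simp
      · rw [if_neg (fun h' => hi (hiff.1 h').2), if_pos h]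
        simp [hi]
    · rw [if_neg (fun h' => h (hiff.1 h').1), if_neg h]; rfl
  rw [hsl]
  split_ifs
  · rfl
  · simp

open Classical in
lemma site_site_single {x y : Vertex k} (hxy : x ≠ y) (A B : Op ι) (s t : Vertex k → ι) :
    site y B (site x A (lp.single 2 s (1 : ℂ))) t =
      if ∀ z, z ≠ x → z ≠ y → t z = s z then
        A (lp.single 2 (s x) (1 : ℂ)) (t x) * B (lp.single 2 (s y) (1 : ℂ)) (t y) else 0 := by
  conv_lhs => rw [site, amp_apply]
  have hsl : slice (splitSite y) (splitSite y t).1 (site x A (lp.single 2 s (1 : ℂ))) =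
      (if ∀ z, z ≠ x → z ≠ y → t z = s z then A (lp.single 2 (s x) (1 : ℂ)) (t x) else 0) •
        lp.single 2 (s y) (1 : ℂ) := by
    ext i
    rw [slice_apply, site_single, lp.coeFn_smul, Pi.smul_apply, lp.single_apply, Pi.single_apply]
    have hx : (splitSite y).symm ((splitSite y t).1, i) x = t x := by
      simp [hxy, splitSite]
    rw [hx]
    have hiff : (∀ z, z ≠ x → (splitSite y).symm ((splitSite y t).1, i) z = s z) ↔
        (∀ z, z ≠ x → z ≠ y → t z = s z) ∧ i = s y := by
      simp only [splitSite_symm_apply]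
      constructor
      · intro h
        exact ⟨fun z hz hzy => by simpa [hzy, splitSite] using h z hz,
          by simpa using h y hxy.symm⟩
      · rintro ⟨h, rfl⟩ z hz
        by_cases hzy : z = y
        · simp [hzy]
        · simpa [hzy, splitSite] using h z hz hzy
    simp only [hiff]
    by_cases h : ∀ z, z ≠ x → z ≠ y → t z = s z <;> by_cases hi : i = s y <;> simp [h, hi]
  rw [hsl, map_smul, lp.coeFn_smul, Pi.smul_apply, smul_eq_mul, ite_mul, zero_mul]
  rfl

/-- The matrix entries of the product at two distinct sites are symmetric in the sites, and an
operator is determined by its values on basis vectors. -/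
lemma commute_site {x y : Vertex k} (hxy : x ≠ y) (A B : Op ι) :
    Commute (site x A) (site y B) := by
  classical
  refine lp.ext_continuousLinearMap (𝕜 := ℂ) (by norm_num) fun s => ?_
  refine ContinuousLinearMap.ext_ring (lp.ext (funext fun t => ?_))
  change site x A (site y B (lp.single 2 s (1 : ℂ))) t = site y B (site x A (lp.single 2 s (1 : ℂ))) t
  rw [site_site_single hxy, site_site_single hxy.symm, mul_comm]
  refine if_congr ?_ rfl rfl
  exact forall_congr' fun z => ⟨fun h h1 h2 => h h2 h1, fun h h1 h2 => h h2 h1⟩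

end Commutation

/-! ### Products along a ray and the telescoping identity -/

section Paths

variable {k : ℕ} {ι : Type*} {𝒜 : StarSubalgebra ℂ (Op ι)}

lemma list_prod_map_eq_single {α M : Type*} [Monoid M] {l : List α} (hl : l.Nodup) {v : α}
    (hv : v ∈ l) (g : α → M) (hg : ∀ u, u ≠ v → g u = 1) : (l.map g).prod = g v := by
  have hone : ∀ l' : List α, v ∉ l' → (l'.map g).prod = 1 := fun l' h' =>
    List.prod_eq_one fun y hy => by
      obtain ⟨u, hu, rfl⟩ := List.mem_map.1 hy
      exact hg u fun h => h' (h ▸ hu)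
  induction l with
  | nil => simp at hv
  | cons u l ih =>
    rw [List.map_cons, List.prod_cons]
    by_cases hu : u = v
    · subst hu
      rw [hone l (List.nodup_cons.1 hl).1, mul_one]
    · rw [hg u hu, one_mul]
      exact ih (List.nodup_cons.1 hl).2 (by simpa [Ne.symm hu] using hv)

lemma vertex_succ (r : Ray k) (n : ℕ) : vertex r (n + 1) = vertex r n ++ [r n] := by
  simp [vertex, List.range_succ]

lemma vertex_length (r : Ray k) (n : ℕ) : (vertex r n).length = n := by simp [vertex]

lemma vertex_mem_level (r : Ray k) (n : ℕ) : vertex r n ∈ level k n := by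
  induction n with
  | zero => simp [vertex, level]
  | succ n ih =>
    rw [vertex_succ, level, List.mem_flatMap]
    exact ⟨_, ih, List.mem_map.2 ⟨r n, List.mem_finRange _, rfl⟩⟩

lemma level_nodup (k n : ℕ) : (level k n).Nodup := by
  induction n with
  | zero => simp [level]
  | succ n ih =>
    rw [level, List.nodup_flatMap]
    refine ⟨fun u _ => (List.nodup_finRange k).map fun i j h => by simpa using h, ?_⟩
    refine ih.imp fun {u v} huv => ?_
    rw [Function.onFun, List.disjoint_left]
    intro w hu hv
    obtain ⟨i, -, rfl⟩ := List.mem_map.1 hu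
    obtain ⟨j, -, h⟩ := List.mem_map.1 hv
    exact huv (List.append_inj_left' h rfl).symm

lemma shift_nil (A : Op (Vertex k → ι)) : shift [] A = A := by
  refine ContinuousLinearMap.ext fun ψ => lp.ext (funext fun t => ?_)
  rw [shift, amp_apply]
  have h : slice (splitShift k ι []) (splitShift k ι [] t).1 ψ = ψ := by
    ext s
    rw [slice_apply]
    refine congrArg ψ (funext fun y => ?_)
    rw [splitShift_symm_apply]
    simp
  rw [h]
  rfl

/-- The product `a₀^{(x₀)} ⋯ a_{n-1}^{(x_{n-1})}` along a ray. -/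
def pathProd (r : Ray k) (a : ℕ → 𝒜) (n : ℕ) : Op (Vertex k → ι) :=
  ((List.range n).map fun m => site (vertex r m) (a m : Op ι)).prod

lemma pathProd_succ (r : Ray k) (a : ℕ → 𝒜) (n : ℕ) :
    pathProd r a (n + 1) = pathProd r a n * site (vertex r n) (a n : Op ι) := by
  simp [pathProd, List.range_succ]

lemma pathProd_mem (r : Ray k) (a : ℕ → 𝒜) (n : ℕ) :
    pathProd r a n ∈ region 𝒜 {x : Vertex k | x.length < n} := by
  refine list_prod_mem fun y hy => ?_
  obtain ⟨m, hm, rfl⟩ := List.mem_map.1 hy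
  refine site_mem_region ?_ (a m).2
  simpa [vertex_length] using hm

/-- The ray `(j, r 0, r 1, …)`, or the sequence with `j` put in front of `r`. -/
def consSeq {α : Type*} (j : α) (r : ℕ → α) : ℕ → α
  | 0 => j
  | n + 1 => r n

lemma vertex_consSeq (j : Fin k) (r : Ray k) (n : ℕ) :
    vertex (consSeq j r) (n + 1) = j :: vertex r n := by
  simp [vertex, List.range_succ_eq_map, consSeq, Function.comp_def]

lemma pathProd_consSeq (j : Fin k) (r : Ray k) (e : 𝒜) (a : ℕ → 𝒜) (n : ℕ) :
    pathProd (consSeq j r) (consSeq e a) (n + 1) =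
      site [] (e : Op ι) * shift [j] (pathProd r a n) := by
  rw [pathProd, pathProd, map_list_prod, List.range_succ_eq_map, List.map_cons, List.prod_cons,
    List.map_map, List.map_map]
  congr 2
  refine List.map_congr_left fun m _ => ?_
  simp only [Function.comp_apply]
  rw [shift_site, vertex_consSeq]
  rfl

lemma coe_list_prod_siteLoc (r : Ray k) (a : ℕ → 𝒜) (n : ℕ) :
    ((((List.range n).map fun m => siteLoc (vertex r m) (a m)).prod : localAlg k 𝒜) :
      Op (Vertex k → ι)) = pathProd r a n := by
  induction n with
  | zero => rfl
  | succ n ih =>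
    rw [pathProd_succ, ← ih, List.range_succ, List.map_append, List.prod_append]
    simp [siteLoc]

lemma coe_tauInf (r : Ray k) (e : 𝒜) (n : ℕ) : (tauInf r e n : Op (Vertex k → ι)) =
    pathProd r (fun _ => 1 - e) n * site (vertex r n) ((1 - e : 𝒜) : Op ι) := by
  rw [tauInf, coe_list_prod_siteLoc r fun _ => 1 - e, pathProd_succ]

lemma siteLoc_one_sub (x : Vertex k) (e : 𝒜) : siteLoc x (1 - e) = 1 - siteLoc x e := by
  refine Subtype.ext ?_
  change site x (1 - (e : Op ι)) = 1 - site x (e : Op ι)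
  rw [map_sub, map_one]

/-- Telescoping: with `p` the product of `1 - e` over the first `N` sites, `p e = p - p (1 - e)`. -/
lemma sum_tau_eq (r : Ray k) (e : 𝒜) (N : ℕ) :
    ∑ n ∈ Finset.range N, tau r e n =
      1 - ((List.range N).map fun m => siteLoc (vertex r m) (1 - e)).prod := by
  induction N with
  | zero => simp
  | succ N ih =>
    rw [Finset.sum_range_succ, ih, List.range_succ, List.map_append, List.prod_append, tau]
    simp only [List.map_cons, List.map_nil, List.prod_cons, List.prod_nil, mul_one]
    rw [siteLoc_one_sub (vertex r N) e]
    noncomm_ring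

lemma rootTensorShift_sub (r : Ray k) (e : 𝒜) (a b : localAlg k 𝒜) :
    rootTensorShift r e (a - b) = rootTensorShift r e a - rootTensorShift r e b := by
  refine Subtype.ext ?_
  change site [] (e : Op ι) * shift (vertex r 1) ((a : Op (Vertex k → ι)) - (b : Op (Vertex k → ι))) =
    site [] (e : Op ι) * shift (vertex r 1) a - site [] (e : Op ι) * shift (vertex r 1) b
  rw [map_sub, mul_sub]

lemma rootTensorShift_zero (r : Ray k) (e : 𝒜) :
    rootTensorShift r e (0 : localAlg k 𝒜) = 0 := by
  simpa using rootTensorShift_sub r e (0 : localAlg k 𝒜) 0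

lemma rootTensorShift_add (r : Ray k) (e : 𝒜) (a b : localAlg k 𝒜) :
    rootTensorShift r e (a + b) = rootTensorShift r e a + rootTensorShift r e b := by
  rw [← sub_eq_iff_eq_add, ← rootTensorShift_sub, add_sub_cancel_right]

lemma rootTensorShift_one (r : Ray k) (e : 𝒜) :
    rootTensorShift r e (1 : localAlg k 𝒜) = siteLoc [] e := by
  refine Subtype.ext ?_
  change site [] (e : Op ι) * shift (vertex r 1) (1 : Op (Vertex k → ι)) = site [] (e : Op ι)
  rw [map_one, mul_one]

lemma sum_rootTensorShift_tau (r : Ray k) (e : 𝒜) (N : ℕ) :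
    ∑ n ∈ Finset.range (N + 1), rootTensorShift r e (tau r e n) =
      siteLoc [] e - rootTensorShift r e (tauInf r e N) := by
  have h : ∀ M : ℕ, ∑ n ∈ Finset.range M, rootTensorShift r e (tau r e n) =
      rootTensorShift r e (∑ n ∈ Finset.range M, tau r e n) := fun M =>
    (map_sum (⟨⟨rootTensorShift r e, rootTensorShift_zero r e⟩, rootTensorShift_add r e⟩ :
      localAlg k 𝒜 →+ localAlg k 𝒜) _ _).symm
  rw [h, sum_tau_eq, rootTensorShift_sub, rootTensorShift_one, tauInf]

lemma pairTensor_sub (a : 𝒜) (j : Fin k) (b c : 𝒜) :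
    pairTensor a j (b - c) = pairTensor a j b - pairTensor a j c := by
  refine Subtype.ext ?_
  change site [] (a : Op ι) * site [j] ((b : Op ι) - (c : Op ι)) =
    site [] (a : Op ι) * site [j] (b : Op ι) - site [] (a : Op ι) * site [j] (c : Op ι)
  rw [map_sub, mul_sub]

lemma pairTensor_smul (a : 𝒜) (j : Fin k) (t : ℂ) (b : 𝒜) :
    pairTensor a j (t • b) = t • pairTensor a j b := by
  refine Subtype.ext ?_
  change site [] (a : Op ι) * site [j] (t • (b : Op ι)) =
    t • (site [] (a : Op ι) * site [j] (b : Op ι))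
  rw [map_smul, mul_smul_comm]

lemma pairTensor_one (a : 𝒜) (j : Fin k) : pairTensor a j 1 = rootTensor k a := by
  refine Subtype.ext ?_
  change site [] (a : Op ι) * site [j] (1 : Op ι) = site [] (a : Op ι)
  rw [map_one, mul_one]

lemma rootTensor_sub (a b : 𝒜) :
    rootTensor k (a - b) = rootTensor k a - rootTensor k b := by
  refine Subtype.ext ?_
  change site [] ((a : Op ι) - (b : Op ι)) = site [] (a : Op ι) - site [] (b : Op ι)
  rw [map_sub]

lemma rootTensor_one : rootTensor k (1 : 𝒜) = 1 := by
  refine Subtype.ext ?_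
  change site [] (1 : Op ι) = 1
  rw [map_one]

/-- Commutation of the root with its successor, together with `p = p* p`, exhibits `p ⊗ c* c` as a
square. It reduces positivity of `𝓔(p ⊗ ·)` to that of `𝓔`. -/
lemma pairTensor_star_mul_self {p : 𝒜} (hp : IsStarProjection p) (j : Fin k) (c : 𝒜) :
    pairTensor p j (star c * c) = star (pairTensor p j c) * pairTensor p j c := by
  refine Subtype.ext ?_
  change site [] (p : Op ι) * site [j] (star (c : Op ι) * (c : Op ι)) =
    star (site [] (p : Op ι) * site [j] (c : Op ι)) * (site [] (p : Op ι) * site [j] (c : Op ι))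
  have hs : star (p : Op ι) = p := congrArg Subtype.val hp.isSelfAdjoint.star_eq
  have hi : (p : Op ι) * p = p := congrArg Subtype.val hp.isIdempotentElem.eq
  have hcomm : site ([] : Vertex k) (p : Op ι) * site [j] (star (c : Op ι)) =
      site [j] (star (c : Op ι)) * site [] (p : Op ι) :=
    commute_site (by simp) _ _
  have hpp : site ([] : Vertex k) (p : Op ι) * site [] (p : Op ι) = site [] (p : Op ι) := by
    rw [← map_mul, hi]
  rw [star_mul, ← map_star, ← map_star, hs, map_mul, ← mul_assoc, hcomm, mul_assoc,
    mul_assoc, ← mul_assoc (site [] _) (site [] _), hpp]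

end Paths

/-! ### The expectation `E_{o]}` along a ray as a nested transition -/

namespace TreeHomogeneousQMC

variable {k : ℕ} {ι : Type*} {𝒜 : StarSubalgebra ℂ (Op ι)} (Q : TreeHomogeneousQMC k 𝒜)

/-- The nested transition `𝓔(a₀ ⊗ 𝓔(a₁ ⊗ ⋯ 𝓔(a_{n-1} ⊗ b)))` along a ray. -/
def nest (r : Ray k) (a : ℕ → 𝒜) : ℕ → 𝒜 → 𝒜
  | 0, b => b
  | n + 1, b => nest r a n (Q.trans (pairTensor (a n) (r n) b))

lemma nest_consSeq (j : Fin k) (r : Ray k) (e : 𝒜) (a : ℕ → 𝒜) (n : ℕ) (b : 𝒜) :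
    Q.nest (consSeq j r) (consSeq e a) (n + 1) b =
      Q.trans (pairTensor e j (Q.nest r a n b)) := by
  induction n generalizing b with
  | zero => rfl
  | succ n ih => exact ih _

/-- With 1 at every interior site each inner transition is some `P^{(j)}`. The letter `r 0` is spent
on the outermost `𝓔(e ⊗ ·)`, so the backward operators start at index 1. -/
lemma nest_consSeq_one (r : Ray k) (e : 𝒜) (n : ℕ) (b : 𝒜) :
    Q.nest r (consSeq e fun _ => 1) (n + 1) b =
      Q.trans (pairTensor e (r 0) (Q.Pray r 1 n b)) := by
  induction n generalizing b with
  | zero => rfl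
  | succ n ih =>
    refine (ih _).trans ?_
    change _ = Q.trans (pairTensor e (r 0) (Q.Pray r 1 n (Q.trans (pairTensor 1 (r (1 + n)) b))))
    rw [add_comm 1 n]
    rfl

lemma cond_path (r : Ray k) (a : ℕ → 𝒜) (n : ℕ) (B : region 𝒜 (ball k 1))
    (x : region 𝒜 (ball k (n + 1)))
    (hx : (x : Op (Vertex k → ι)) = pathProd r a n * shift (vertex r n) B) :
    (Q.cond n x : Op (Vertex k → ι)) =
      pathProd r a n * site (vertex r n) (Q.trans B : Op ι) := by
  classical
  have hprod := fun {M : Type _} [Monoid M] (g : Vertex k → M) hg =>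
    list_prod_map_eq_single (level_nodup k n) (vertex_mem_level r n) g hg
  -- Put `B` at the ray's vertex and 1 at the rest of the level; both tensor products then collapse
  -- to one factor, since `𝓔` is unital.
  rw [Q.cond_tensor n (pathProd r a n) (fun u => if u = vertex r n then B else 1) x
    (pathProd_mem r a n)]
  · rw [hprod]
    · rw [if_pos rfl]
    · intro u hu
      rw [if_neg hu, Q.trans_markov.map_one]
      exact map_one _
  · rw [hx, hprod]
    · rw [if_pos rfl]
    · intro u hu
      rw [if_neg hu]
      exact map_one _

/-- Each conditional expectation turns the outermost block `B` into `𝓔(B)` at one site, which joins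
the preceding factor `a n` to form a new block based one level closer to the root. -/
lemma iterCond_path (r : Ray k) (a : ℕ → 𝒜) (n : ℕ) (B : region 𝒜 (ball k 1))
    (x : region 𝒜 (ball k (n + 1)))
    (hx : (x : Op (Vertex k → ι)) = pathProd r a n * shift (vertex r n) B) :
    iterCond Q.trans Q.cond n x = Q.nest r a n (Q.trans B) := by
  induction n generalizing B with
  | zero =>
    have : x = B := Subtype.ext (by
      rw [hx]
      change 1 * shift [] _ = _
      rw [one_mul, shift_nil])
    rw [this]
    rfl
  | succ n ih =>
    refine ih (pairTensor (a n) (r n) (Q.trans B)) (Q.cond (n + 1) x) ?_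
    rw [Q.cond_path r a (n + 1) B x hx, pathProd_succ, mul_assoc]
    congr 1
    change _ = shift _ (site [] _ * site [r n] _)
    rw [map_mul, shift_site, shift_site, List.append_nil, ← vertex_succ]

/-- The module property applied to `x · 1`, with `E(1) = 1`. It makes the iterated expectation
independent of the level from which it is started. -/
lemma cond_of_mem (n : ℕ) (x : region 𝒜 (ball k (n + 2)))
    (hx : (x : Op (Vertex k → ι)) ∈ region 𝒜 (ball k n)) :
    (Q.cond (n + 1) x : Op (Vertex k → ι)) = x := by
  have h := Q.cond_module (n + 1) x 1 (region_mono (fun y hy => Nat.lt_succ_of_le hy) hx)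
  rw [mul_one, (Q.cond_markov (n + 1)).map_one] at h
  rw [h]
  exact mul_one _

lemma iterCond_add (m n : ℕ) (a : Op (Vertex k → ι)) (ha : a ∈ region 𝒜 (ball k m)) :
    iterCond Q.trans Q.cond (m + n) ⟨a, region_mono (ball_mono (by omega)) ha⟩ =
      iterCond Q.trans Q.cond m ⟨a, region_mono (ball_mono (by omega)) ha⟩ := by
  induction n with
  | zero => rfl
  | succ n ih =>
    rw [← ih]
    refine congrArg (iterCond Q.trans Q.cond (m + n)) (Subtype.ext ?_)
    exact Q.cond_of_mem (m + n) ⟨a, _⟩ (region_mono (ball_mono (by omega)) ha)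

lemma Eo_eq_iterCond (n : ℕ) (a : localAlg k 𝒜)
    (ha : (a : Op (Vertex k → ι)) ∈ region 𝒜 (ball k n)) :
    Q.Eo a = iterCond Q.trans Q.cond n ⟨a, region_mono (ball_mono (Nat.le_succ _)) ha⟩ := by
  classical
  obtain ⟨d, rfl⟩ := Nat.exists_eq_add_of_le (Nat.find_min' a.2 ha)
  rw [Q.iterCond_add _ d a (Nat.find_spec a.2), Eo]

lemma Eo_sub (a b : localAlg k 𝒜) : Q.Eo (a - b) = Q.Eo a - Q.Eo b := by
  obtain ⟨m, hm⟩ := a.2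
  obtain ⟨n, hn⟩ := b.2
  have ha : (a : Op (Vertex k → ι)) ∈ region 𝒜 (ball k (max m n)) :=
    region_mono (ball_mono (le_max_left _ _)) hm
  have hb : (b : Op (Vertex k → ι)) ∈ region 𝒜 (ball k (max m n)) :=
    region_mono (ball_mono (le_max_right _ _)) hn
  rw [Q.Eo_eq_iterCond _ a ha, Q.Eo_eq_iterCond _ b hb, Q.Eo_eq_iterCond _ (a - b) (sub_mem ha hb),
    ← map_sub]
  rfl

lemma Eo_path (r : Ray k) (a : ℕ → 𝒜) (n : ℕ) (b : 𝒜) (x : localAlg k 𝒜)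
    (hx : (x : Op (Vertex k → ι)) = pathProd r a n * site (vertex r n) (b : Op ι)) :
    Q.Eo x = Q.nest r a n (Q.T b) := by
  have hmem : (x : Op (Vertex k → ι)) ∈ region 𝒜 (ball k n) := by
    rw [hx]
    exact mul_mem (region_mono (fun y (hy : y.length < n) => hy.le) (pathProd_mem r a n))
      (site_mem_region (vertex_length r n).le b.2)
  rw [Q.Eo_eq_iterCond n x hmem]
  refine Q.iterCond_path r a n (rootTensor k b) _ ?_
  change (x : Op (Vertex k → ι)) = pathProd r a n * shift _ (site [] (b : Op ι))
  rw [hx, shift_site, List.append_nil]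

/-- The sequence defining `φ` on a local observable is constant, because the additional conditional
expectations fix it. -/
lemma stateLoc_eq (a : localAlg k 𝒜) : Q.stateLoc a = Q.initial (Q.Eo a) := by
  obtain ⟨m, hm⟩ := a.2
  refine tendsto_nhds_unique (Q.state_limit m a hm) ?_
  rw [Q.Eo_eq_iterCond m a hm]
  refine tendsto_const_nhds.congr fun n => ?_
  rw [Q.iterCond_add m n a hm]

lemma stateLoc_sub (a b : localAlg k 𝒜) : Q.stateLoc (a - b) = Q.stateLoc a - Q.stateLoc b := by
  rw [stateLoc_eq, stateLoc_eq, stateLoc_eq, Eo_sub, map_sub]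

lemma Eo_tauInf (r : Ray k) (e : 𝒜) (n : ℕ) :
    Q.Eo (tauInf r e n) = Q.nest r (fun _ => 1 - e) n (Q.T (1 - e)) :=
  Q.Eo_path r _ n _ _ (coe_tauInf r e n)

lemma Eo_rootTensorShift_tauInf (r : Ray k) (e : 𝒜) (n : ℕ) :
    Q.Eo (rootTensorShift r e (tauInf r e n)) =
      Q.trans (pairTensor e (r 0) (Q.Eo (tauInf r e n))) := by
  -- Shifting by `x_1` places the product on the ray `(r 0, r 0, r 1, …)`, whose nested transition
  -- is that of `r` inside one further `𝓔(e ⊗ ·)`.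
  rw [Eo_tauInf, ← nest_consSeq]
  refine Q.Eo_path _ _ (n + 1) _ _ ?_
  change site [] (e : Op ι) * shift [r 0] (tauInf r e n : Op (Vertex k → ι)) = _
  rw [coe_tauInf, map_mul, ← mul_assoc, pathProd_consSeq, shift_site, vertex_consSeq]
  rfl

lemma Eo_siteLoc_root (e : 𝒜) : Q.Eo (siteLoc [] e) = Q.trans (rootTensor k e) := by
  have hmem : ((siteLoc [] e : localAlg k 𝒜) : Op (Vertex k → ι)) ∈ region 𝒜 (ball k 0) :=
    site_mem_region (show ([] : Vertex k) ∈ ball k 0 from le_refl 0) e.2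
  rw [Q.Eo_eq_iterCond 0 (siteLoc [] e) hmem]
  rfl

lemma Eo_mul_siteLoc_vertex (r : Ray k) (e f : 𝒜) (m : ℕ) :
    Q.Eo (siteLoc [] e * siteLoc (vertex r (m + 1)) f) =
      Q.trans (pairTensor e (r 0) (Q.Pray r 1 m (Q.T f))) := by
  rw [← nest_consSeq_one]
  refine Q.Eo_path _ _ (m + 1) _ _ ?_
  change site [] (e : Op ι) * site _ (f : Op ι) = _
  congr 1
  induction m with
  | zero => simp [pathProd, consSeq, vertex]
  | succ m ih =>
    rw [pathProd_succ, ← ih]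
    change _ = _ * site _ (1 : Op ι)
    rw [map_one, mul_one]

/-! ### Positivity, monotonicity and continuity of transitions -/

lemma trans_star_mul_self_nonneg (d : region 𝒜 (ball k 1)) :
    (0 : Op ι) ≤ Q.trans (star d * d) := by
  rw [op_nonneg_iff]
  intro v
  have h := Q.trans_markov.cp 1 (fun _ => d) fun _ => v
  rw [Fin.sum_univ_one, Fin.sum_univ_one] at h
  exact h

variable (h𝒜 : IsClosed (𝒜 : Set (Op ι)))
include h𝒜

lemma trans_pairTensor_nonneg {p : 𝒜} (hp : IsStarProjection p) (j : Fin k) {b : 𝒜}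
    (hb : (0 : Op ι) ≤ b) : (0 : Op ι) ≤ Q.trans (pairTensor p j b) := by
  obtain ⟨c, rfl⟩ := exists_star_mul_self_eq h𝒜 hb
  rw [pairTensor_star_mul_self hp]
  exact Q.trans_star_mul_self_nonneg _

lemma trans_pairTensor_mono {p : 𝒜} (hp : IsStarProjection p) (j : Fin k) {b c : 𝒜}
    (hbc : (b : Op ι) ≤ c) :
    (Q.trans (pairTensor p j b) : Op ι) ≤ Q.trans (pairTensor p j c) := by
  have h := Q.trans_pairTensor_nonneg h𝒜 hp j (b := c - b) (sub_nonneg.2 hbc)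
  rw [pairTensor_sub, map_sub] at h
  exact sub_nonneg.1 h

lemma trans_pairTensor_le {p : 𝒜} (hp : IsStarProjection p) (j : Fin k) {b : 𝒜}
    (hb : (b : Op ι) ≤ 1) : (Q.trans (pairTensor p j b) : Op ι) ≤ Q.T p := by
  have h := Q.trans_pairTensor_mono h𝒜 hp j (c := 1) hb
  rwa [pairTensor_one] at h

/-- `1 - T(p) = 𝓔((1 - p) ⊗ 1)` is positive. The index `j` supplies a successor of the root, so that
`p ⊗ 1` can be written as a pair. -/
lemma T_le_one (j : Fin k) {p : 𝒜} (hp : IsStarProjection p) : (Q.T p : Op ι) ≤ 1 := by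
  have h := Q.trans_pairTensor_nonneg h𝒜 hp.one_sub j (b := 1) zero_le_one
  rw [pairTensor_one, rootTensor_sub, rootTensor_one, map_sub, Q.trans_markov.map_one] at h
  exact sub_nonneg.1 h

lemma T_nonneg (j : Fin k) {p : 𝒜} (hp : IsStarProjection p) : (0 : Op ι) ≤ Q.T p := by
  have h := Q.trans_pairTensor_nonneg h𝒜 hp j (b := 1) zero_le_one
  rwa [pairTensor_one] at h

variable {a : ℕ → 𝒜} (ha : ∀ n, IsStarProjection (a n))
include ha

lemma nest_nonneg (r : Ray k) (n : ℕ) {b : 𝒜} (hb : (0 : Op ι) ≤ b) :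
    (0 : Op ι) ≤ Q.nest r a n b := by
  induction n generalizing b with
  | zero => exact hb
  | succ n ih => exact ih (Q.trans_pairTensor_nonneg h𝒜 (ha n) _ hb)

lemma nest_mono (r : Ray k) (n : ℕ) {b c : 𝒜} (hbc : (b : Op ι) ≤ c) :
    (Q.nest r a n b : Op ι) ≤ Q.nest r a n c := by
  induction n generalizing b c with
  | zero => exact hbc
  | succ n ih => exact ih (Q.trans_pairTensor_mono h𝒜 (ha n) _ hbc)

lemma nest_le_one (r : Ray k) (n : ℕ) {b : 𝒜} (hb : (b : Op ι) ≤ 1) :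
    (Q.nest r a n b : Op ι) ≤ 1 := by
  induction n generalizing b with
  | zero => exact hb
  | succ n ih =>
    exact ih ((Q.trans_pairTensor_le h𝒜 (ha n) _ hb).trans (Q.T_le_one h𝒜 (r n) (ha n)))

omit ha

variable {e : 𝒜} (he : IsStarProjection e)
include he

lemma Eo_tauInf_nonneg (r : Ray k) (n : ℕ) : (0 : Op ι) ≤ Q.Eo (tauInf r e n) := by
  rw [Eo_tauInf]
  exact Q.nest_nonneg h𝒜 (fun _ => he.one_sub) r n (Q.T_nonneg h𝒜 (r 0) he.one_sub)

lemma Eo_tauInf_le_one (r : Ray k) (n : ℕ) : (Q.Eo (tauInf r e n) : Op ι) ≤ 1 := by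
  rw [Eo_tauInf]
  exact Q.nest_le_one h𝒜 (fun _ => he.one_sub) r n (Q.T_le_one h𝒜 (r 0) he.one_sub)

/-- One more step replaces the innermost `T(1 - e)` by `𝓔((1 - e) ⊗ T(1 - e))`, which is smaller
because `T(1 - e) ≤ 1`. -/
lemma Eo_tauInf_succ_le (r : Ray k) (n : ℕ) :
    (Q.Eo (tauInf r e (n + 1)) : Op ι) ≤ Q.Eo (tauInf r e n) := by
  rw [Eo_tauInf, Eo_tauInf]
  exact Q.nest_mono h𝒜 (fun _ => he.one_sub) r n
    (Q.trans_pairTensor_le h𝒜 he.one_sub _ (Q.T_le_one h𝒜 (r 0) he.one_sub))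

/-- A decreasing sequence stays above its norm limit, so `0 ≤ 𝓔(e ⊗ (b n - L)) ≤ ‖b n - L‖ T(e)`,
and the norm of the middle term tends to 0. -/
lemma tendsto_trans_pairTensor (j : Fin k) {b : ℕ → 𝒜} {L : 𝒜}
    (hanti : ∀ n, (b (n + 1) : Op ι) ≤ b n) (hL : Tendsto b atTop (𝓝 L)) :
    Tendsto (fun n => Q.trans (pairTensor e j (b n))) atTop (𝓝 (Q.trans (pairTensor e j L))) := by
  have hL' : Tendsto (fun n => (b n : Op ι)) atTop (𝓝 (L : Op ι)) := tendsto_subtype_rng.1 hL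
  have hle : ∀ n, (L : Op ι) ≤ b n := fun n =>
    (antitone_nat_of_succ_le (f := fun n => (b n : Op ι)) hanti).le_of_tendsto hL' n
  rw [tendsto_subtype_rng, tendsto_iff_norm_sub_tendsto_zero]
  rw [tendsto_iff_norm_sub_tendsto_zero] at hL'
  have hbound := hL'.mul_const ‖(Q.T e : Op ι)‖
  rw [zero_mul] at hbound
  refine squeeze_zero (fun _ => norm_nonneg _) (fun n => ?_) hbound
  have h0 : (0 : Op ι) ≤ (b n - L : 𝒜) := sub_nonneg.2 (hle n)
  have h1 : ((b n - L : 𝒜) : Op ι) ≤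
      (((‖(b n : Op ι) - (L : Op ι)‖ : ℂ) • (1 : 𝒜) : 𝒜) : Op ι) := le_norm_smul_one h0
  have h2 := Q.trans_pairTensor_mono h𝒜 he j h1
  have h3 := Q.trans_pairTensor_nonneg h𝒜 he j h0
  rw [pairTensor_smul, pairTensor_one, map_smul] at h2
  rw [pairTensor_sub, map_sub] at h2 h3
  refine (norm_le_norm_of_nonneg_of_le h3 h2).trans (le_of_eq ?_)
  refine (norm_smul (‖(b n : Op ι) - (L : Op ι)‖ : ℂ) (Q.T e : Op ι)).trans ?_
  rw [Complex.norm_real, norm_norm]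

end TreeHomogeneousQMC

/-! ### The equivalences for recurrence and accessibility -/

namespace TreeHomogeneousQMC

variable {k : ℕ} {ι : Type*} {𝒜 : StarSubalgebra ℂ (Op ι)} (Q : TreeHomogeneousQMC k 𝒜)

lemma eRecurrent_iff (e : 𝒜) : Q.ERecurrent e ↔ Q.TraceNondegenerate e ∧ ∀ r : Ray k,
    Tendsto (fun n : ℕ => (posTrace (Q.T e : Op ι))⁻¹ * posTrace ((Q.T e : Op ι) -
      (Q.trans (pairTensor e (r 0) (Q.Eo (tauInf r e n))) : Op ι))) atTop (𝓝 1) := by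
  refine and_congr_right fun _ => forall_congr' fun r => ?_
  -- The sum of the first `N + 1` terms telescopes to `τ_{e;x_N;∞}`, which occupies the sites `x_0,
  -- …, x_N`.
  rw [← tendsto_add_atTop_iff_nat 1]
  simp only [sum_rootTensorShift_tau, Eo_sub, Eo_siteLoc_root, Eo_rootTensorShift_tauInf]
  rfl

lemma phiRecurrent_iff (e : 𝒜) : Q.PhiRecurrent e ↔ Q.stateLoc (siteLoc [] e) ≠ 0 ∧
    ∀ r : Ray k, Tendsto (fun n => Q.stateLoc (rootTensorShift r e (tauInf r e n))) atTop (𝓝 0) := by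
  refine and_congr_right fun h0 => forall_congr' fun r => ?_
  rw [← tendsto_add_atTop_iff_nat 1]
  simp only [sum_rootTensorShift_tau, stateLoc_sub, mul_sub, inv_mul_cancel₀ h0]
  constructor
  · intro h
    have h1 := (tendsto_const_nhds (x := (1 : ℂ))).sub h
    have h2 := h1.const_mul (Q.stateLoc (siteLoc [] e))
    simpa [mul_inv_cancel_left₀ h0] using h2
  · intro h
    have h1 := h.const_mul (Q.stateLoc (siteLoc [] e))⁻¹
    simpa using (tendsto_const_nhds (x := (1 : ℂ))).sub h1

lemma eAccessible_iff (e f : 𝒜) : Q.EAccessible e f ↔ ∀ r : Ray k, ∃ m : ℕ, 1 ≤ m ∧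
    Q.trans (pairTensor e (r 0) (Q.Pray r 1 (m - 1) (Q.T f))) ≠ 0 := by
  refine forall_congr' fun r => exists_congr fun m => and_congr_right fun hm => ?_
  obtain ⟨m, rfl⟩ := Nat.exists_eq_add_of_le' hm
  rw [Eo_mul_siteLoc_vertex, Nat.add_sub_cancel]

lemma phiAccessible_iff (e f : 𝒜) : Q.PhiAccessible e f ↔ ∀ r : Ray k, ∃ m : ℕ, 1 ≤ m ∧
    Q.initial (Q.trans (pairTensor e (r 0) (Q.Pray r 1 (m - 1) (Q.T f)))) ≠ 0 := by
  refine forall_congr' fun r => exists_congr fun m => and_congr_right fun hm => ?_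
  obtain ⟨m, rfl⟩ := Nat.exists_eq_add_of_le' hm
  rw [stateLoc_eq, Eo_mul_siteLoc_vertex, Nat.add_sub_cancel]

variable (h𝒜 : IsClosed (𝒜 : Set (Op ι))) {e : 𝒜} (he : IsStarProjection e)
include h𝒜 he

lemma eRecurrent_iff_tendsto : Q.ERecurrent e ↔ Q.TraceNondegenerate e ∧ ∀ r : Ray k,
    Tendsto (fun n => Q.trans (pairTensor e (r 0) (Q.Eo (tauInf r e n)))) atTop (𝓝 0) := by
  rw [eRecurrent_iff]
  refine and_congr_right fun h => forall_congr' fun r => ?_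
  rw [tendsto_subtype_rng]
  exact tendsto_normalized_posTrace_iff_tendsto h.1 h.2
    (fun n => Q.trans_pairTensor_nonneg h𝒜 he _ (Q.Eo_tauInf_nonneg h𝒜 he r n))
    fun n => Q.trans_pairTensor_le h𝒜 he _ (Q.Eo_tauInf_le_one h𝒜 he r n)

lemma eRecurrent_iff_weakTendsto : Q.ERecurrent e ↔ Q.TraceNondegenerate e ∧ ∀ r : Ray k,
    WeakTendsto (fun n => (Q.trans (pairTensor e (r 0) (Q.Eo (tauInf r e n))) : Op ι)) 0 := by
  rw [eRecurrent_iff]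
  refine and_congr_right fun h => forall_congr' fun r => ?_
  exact tendsto_normalized_posTrace_iff_weakTendsto h.1 h.2
    (fun n => Q.trans_pairTensor_nonneg h𝒜 he _ (Q.Eo_tauInf_nonneg h𝒜 he r n))
    fun n => Q.trans_pairTensor_le h𝒜 he _ (Q.Eo_tauInf_le_one h𝒜 he r n)

lemma eRecurrent_iff_of_tendsto {L : Ray k → 𝒜}
    (hL : ∀ r, Tendsto (fun n => Q.Eo (tauInf r e n)) atTop (𝓝 (L r))) :
    Q.ERecurrent e ↔ Q.TraceNondegenerate e ∧ ∀ r : Ray k,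
      Q.trans (pairTensor e (r 0) (L r)) = 0 := by
  rw [Q.eRecurrent_iff_tendsto h𝒜 he]
  refine and_congr_right fun _ => forall_congr' fun r => ?_
  have h := Q.tendsto_trans_pairTensor h𝒜 he (r 0) (Q.Eo_tauInf_succ_le h𝒜 he r) (hL r)
  exact ⟨fun h0 => tendsto_nhds_unique h h0, fun h0 => h0 ▸ h⟩

/-- The operators `E_{o]}(τ_{e;x_n;∞})` are positive and decreasing, so normality carries their weak
limit through `𝓔(e ⊗ ·)`; weak limits are unique. -/
lemma eRecurrent_iff_of_weakTendsto {L : Ray k → 𝒜}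
    (hL : ∀ r, WeakTendsto (fun n => (Q.Eo (tauInf r e n) : Op ι)) (L r))
    (hn : ∀ j : Fin k, IsSeqNormal fun b : 𝒜 => Q.trans (pairTensor e j b)) :
    Q.ERecurrent e ↔ Q.TraceNondegenerate e ∧ ∀ r : Ray k,
      Q.trans (pairTensor e (r 0) (L r)) = 0 := by
  rw [Q.eRecurrent_iff_weakTendsto h𝒜 he]
  refine and_congr_right fun _ => forall_congr' fun r => ?_
  have h := hn (r 0) _ (L r) (Q.Eo_tauInf_nonneg h𝒜 he r) (Q.Eo_tauInf_succ_le h𝒜 he r) (hL r)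
  exact ⟨fun h0 => Subtype.ext (h.unique h0), fun h0 => by simp only [h0] at h; exact h⟩

end TreeHomogeneousQMC

end

end TreeQMC

theorem mainTheorem1 {k : ℕ} {ι : Type*} (𝒜 : StarSubalgebra ℂ (Op ι))
    (h𝒜 : IsClosed (𝒜 : Set (Op ι))) (Q : TreeHomogeneousQMC k 𝒜)
    (e f : 𝒜) (he : IsStarProjection e) (hf : IsStarProjection f) :
    -- (i), with the limit over `n` taken of `𝓔(e ⊗ E_{o]}(τ_{e;x_n;∞}))`
    (Q.ERecurrent e ↔ Q.TraceNondegenerate e ∧ ∀ r : Ray k,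
      Tendsto (fun n => Q.trans (pairTensor e (r 0) (Q.Eo (tauInf r e n)))) atTop (𝓝 0)) ∧
    -- (i), when the limits `L r` of `E_{o]}(τ_{e;x_n;∞})` exist in norm
    (∀ L : Ray k → 𝒜, (∀ r, Tendsto (fun n => Q.Eo (tauInf r e n)) atTop (𝓝 (L r))) →
      (Q.ERecurrent e ↔ Q.TraceNondegenerate e ∧ ∀ r : Ray k,
        Q.trans (pairTensor e (r 0) (L r)) = 0)) ∧
    -- (i), when they exist in the weak operator topology and `b ↦ 𝓔(e ⊗ b)` is normal
    (∀ L : Ray k → 𝒜,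
      (∀ r, WeakTendsto (fun n => (Q.Eo (tauInf r e n) : Op ι)) (L r)) →
      (∀ j : Fin k, IsSeqNormal fun b : 𝒜 => Q.trans (pairTensor e j b)) →
      (Q.ERecurrent e ↔ Q.TraceNondegenerate e ∧ ∀ r : Ray k,
        Q.trans (pairTensor e (r 0) (L r)) = 0)) ∧
    -- (ii)
    (Q.PhiRecurrent e ↔ Q.stateLoc (siteLoc [] e) ≠ 0 ∧ ∀ r : Ray k,
      Tendsto (fun n => Q.stateLoc (rootTensorShift r e (tauInf r e n))) atTop (𝓝 0)) ∧
    -- (iii)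
    (Q.EAccessible e f ↔ ∀ r : Ray k, ∃ m : ℕ, 1 ≤ m ∧
      Q.trans (pairTensor e (r 0) (Q.Pray r 1 (m - 1) (Q.T f))) ≠ 0) ∧
    -- (iv)
    (Q.PhiAccessible e f ↔ ∀ r : Ray k, ∃ m : ℕ, 1 ≤ m ∧
      Q.initial (Q.trans (pairTensor e (r 0) (Q.Pray r 1 (m - 1) (Q.T f)))) ≠ 0) :=
  ⟨Q.eRecurrent_iff_tendsto h𝒜 he, fun _ => Q.eRecurrent_iff_of_tendsto h𝒜 he,
    fun _ => Q.eRecurrent_iff_of_weakTendsto h𝒜 he, Q.phiRecurrent_iff e, Q.eAccessible_iff e f,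
    Q.phiAccessible_iff e f⟩
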